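/- Let $k$ be a field of characteristic $0$, and let $\Theta$ be the variety of all commutative (not necessarily associative, nonunital) algebras over $k$. Let $\Theta^0$ be the category whose objects are the free algebras $F(X)$ of $\Theta$, one for each finite subset $X$ of a fixed countably infinite set of symbols, and whose morphisms are the $k$-algebra homomorphisms. Let $\mathfrak A$ be the group of all automorphisms of the category $\Theta^0$ and $\mathfrak Y\trianglelefteq\mathfrak A$ the subgroup of inner automorphisms, i.e. those isomorphic as functors to the identity functor. An automorphism $\Phi\in\mathfrak A$ is called strongly stable if it preserves all objects and there are bijections $s_F\colon F\to F$ ($F=F(X)\in\mathrm{Ob}\,\Theta^0$) with $s_F|_X=\mathrm{id}_X$ and $\Phi(\psi)=s_F\circ\psi\circ s_D^{-1}$ for every morphism $\psi\colon D\to F$. For $\varphi\in\mathrm{Aut}\,k$ (the group of field automorphisms of $k$) and $\alpha\in k^*$, say that a strongly stable automorphism $\Phi$ has type $(\varphi,\alpha)$ if the bijections $s_F$ can be chosen so that for all $F$, all $f,g\in F$ and all $c\in k$ $$s_F(f+g)=s_F(f)+s_F(g),\qquad s_F(cf)=\varphi(c)\,s_F(f),\qquad s_F(fg)=\alpha\,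 s_F(f)s_F(g).$$ Then $$\mathfrak A/\mathfrak Y\;\cong\;\mathrm{Aut}\,k .$$ More precisely: (1) every strongly stable automorphism has type $(\varphi,\alpha)$ for exactly one pair $(\varphi,\alpha)\in\mathrm{Aut}\,k\times k^*$, and for every such pair there is exactly one strongly stable automorphism $\Phi_{\varphi,\alpha}$ of type $(\varphi,\alpha)$; (2) $\Phi_{\varphi,\alpha}=\Phi_{\mathrm{id},\alpha}\circ\Phi_{\varphi,1}$, and $\Phi_{\mathrm{id},\alpha}$ is inner; (3) there is a group isomorphism $\mathfrak A/\mathfrak Y\to\mathrm{Aut}\,k$ that takes the coset of $\Phi_{\varphi,\alpha}$ to $\varphi$, for all $\varphi\in\mathrm{Aut}\,k$ and $\alpha\in k^*$. -/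

import Mathlib

open CategoryTheory

/-- The congruence on the free magma on `X` generated by commutativity. -/
def freeCommMagmaCon (X : Type*) : Con (FreeMagma X) :=
  conGen fun a b => ∃ u v : FreeMagma X, a = u * v ∧ b = v * u

/-- The free commutative (nonassociative) magma on `X`. -/
abbrev FreeCommMagma (X : Type*) : Type _ :=
  (freeCommMagmaCon X).Quotient

/-- The free commutative nonassociative (nonunital) algebra over `k` on the set `X`:
the magma algebra of the free commutative magma. -/
abbrev FreeCommNAAlgebra (k : Type*) [Field k] (X : Type*) : Type _ :=
  MonoidAlgebra k (FreeCommMagma X)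

namespace FreeCommNAAlgebra

/-- The free generator attached to `x`. -/
noncomputable def gen (k : Type*) [Field k] {X : Type*} (x : X) : FreeCommNAAlgebra k X :=
  MonoidAlgebra.ofMagma k (FreeCommMagma X) (FreeMagma.of x : FreeMagma X)

theorem magma_mul_comm {X : Type*} (a b : FreeCommMagma X) : a * b = b * a := by
  induction a using Con.induction_on with
  | H a =>
    induction b using Con.induction_on with
    | H b =>
      exact (Con.eq _).2 (ConGen.Rel.of _ _ ⟨a, b, rfl, rfl⟩)

/-- The free commutative algebra is commutative. -/
theorem mul_comm' (k : Type*) [Field k] {X : Type*} (f g : FreeCommNAAlgebra k X) :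
    f * g = g * f := by
  induction f using MonoidAlgebra.induction_linear with
  | zero => simp
  | add f f' h h' => rw [add_mul, mul_add, h, h']
  | single a r =>
    induction g using MonoidAlgebra.induction_linear with
    | zero => simp
    | add f f' h h' => rw [add_mul, mul_add, h, h']
    | single b s =>
      rw [MonoidAlgebra.single_mul_single, MonoidAlgebra.single_mul_single,
        magma_mul_comm, mul_comm]

/-- The universal property: every map from `X` to a commutative nonassociative algebra extends
uniquely to a homomorphism of algebras. -/
theorem existsUnique_lift (k : Type*) [Field k] {X A : Type*} [NonUnitalNonAssocCommRing A]
    [Module k A] [IsScalarTower k A A] [SMulCommClass k A A] (f : X → A) :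
    ∃! F : FreeCommNAAlgebra k X →ₙₐ[k] A, ∀ x, F (gen k x) = f x := by
  have hle : freeCommMagmaCon X ≤ Con.ker (FreeMagma.lift f) := by
    refine Con.conGen_le.2 ?_
    rintro _ _ ⟨u, v, rfl, rfl⟩
    simp [Con.ker_rel, mul_comm]
  let m : FreeCommMagma X →ₙ* A :=
    { toFun := fun a => Con.liftOn a (FreeMagma.lift f) fun a b h => hle h
      map_mul' := by
        intro a b
        induction a using Con.induction_on with
        | H a =>
          induction b using Con.induction_on with
          | H b => exact map_mul (FreeMagma.lift f) a b }
  have hm : ∀ x : X, m ((FreeMagma.of x : FreeMagma X) : FreeCommMagma X) = f x := fun x => rfl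
  refine ⟨MonoidAlgebra.liftMagma k m, fun x => ?_, fun G hG => ?_⟩
  · have := DFunLike.congr_fun ((MonoidAlgebra.liftMagma k).symm_apply_apply m)
      ((FreeMagma.of x : FreeMagma X) : FreeCommMagma X)
    exact this.trans (hm x)
  · rw [← (MonoidAlgebra.liftMagma k).apply_symm_apply G]
    congr 1
    ext a
    induction a using Con.induction_on with
    | H a =>
      induction a using FreeMagma.recOnMul with
      | ih1 x => exact (hG x).trans (hm x).symm
      | ih2 a b ha hb =>
        rw [Con.coe_mul, map_mul, map_mul, ha, hb]

end FreeCommNAAlgebra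

/-- The objects of the category of finitely generated free commutative algebras over `k`: one
object `F(X)` for every finite subset `X` of the countable set of symbols `{x₀, x₁, x₂, …}`. -/
structure FreeCommAlgCat (k : Type*) [Field k] where
  /-- the indices of the free generators -/
  gens : Finset ℕ

namespace FreeCommAlgCat

/-- The free commutative algebra `F(X)` that is the object. -/
abbrev Carrier {k : Type*} [Field k] (A : FreeCommAlgCat k) : Type _ :=
  FreeCommNAAlgebra k A.gens

/-- Morphisms are the homomorphisms of `k`-algebras. -/
noncomputable instance category (k : Type*) [Field k] : Category (FreeCommAlgCat k) where
  Hom A B := A.Carrier →ₙₐ[k] B.Carrier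
  id A := NonUnitalAlgHom.id k A.Carrier
  comp f g := NonUnitalAlgHom.comp g f

/-- The underlying algebra homomorphism of a morphism. -/
def toAlgHom {k : Type*} [Field k] {A B : FreeCommAlgCat k} (f : A ⟶ B) :
    A.Carrier →ₙₐ[k] B.Carrier := f

/-- The group `𝔄` of all automorphisms of the category (invertible endofunctors, with
composition: `Φ * Ψ` is `Φ ∘ Ψ`). -/
abbrev Autos (k : Type*) [Field k] : Type _ := Aut (Cat.of (FreeCommAlgCat k))

/-- The functor underlying an automorphism of the category. -/
abbrev functor {k : Type*} [Field k] (Φ : Autos k) : FreeCommAlgCat k ⥤ FreeCommAlgCat k :=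
  Φ.hom.toFunctor

/-- The subgroup `𝔜` of inner automorphisms: those isomorphic, as functors, to the identity. -/
def inner (k : Type*) [Field k] : Subgroup (Autos k) where
  carrier := {Φ | Nonempty (functor Φ ≅ 𝟭 (FreeCommAlgCat k))}
  one_mem' := ⟨Iso.refl _⟩
  mul_mem' := by
    rintro Φ Ψ ⟨a⟩ ⟨b⟩
    exact ⟨(Functor.isoWhiskerRight b (functor Φ)).trans ((Functor.leftUnitor _).trans a)⟩
  inv_mem' := by
    rintro Φ ⟨a⟩
    have h : functor Φ⁻¹ ⋙ functor Φ = 𝟭 _ := congrArg Cat.Hom.toFunctor Φ.inv_hom_id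
    exact ⟨(Functor.rightUnitor _).symm.trans
      ((Functor.isoWhiskerLeft (functor Φ⁻¹) a.symm).trans (eqToIso h))⟩

instance inner_normal (k : Type*) [Field k] : (inner k).Normal where
  conj_mem := by
    rintro Φ ⟨a⟩ Ψ
    have h : functor Ψ⁻¹ ⋙ functor Ψ = 𝟭 _ := congrArg Cat.Hom.toFunctor Ψ.inv_hom_id
    exact ⟨(Functor.isoWhiskerLeft (functor Ψ⁻¹)
      ((Functor.isoWhiskerRight a (functor Ψ)).trans (Functor.leftUnitor _))).trans (eqToIso h)⟩

/-- The automorphism `Φ` preserves all objects, acts on morphisms `ψ : D ⟶ F` by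
`Φ(ψ) = s_F ∘ ψ ∘ s_D⁻¹`, and the bijections `s_F` fix the free generators. The `eqToHom`s only
identify `Φ(D)` with `D` and `Φ(F)` with `F`. -/
structure IsInducedBy {k : Type*} [Field k] (Φ : Autos k)
    (s : ∀ A : FreeCommAlgCat k, A.Carrier ≃ A.Carrier) : Prop where
  obj_eq : ∀ A : FreeCommAlgCat k, (functor Φ).obj A = A
  map_eq : ∀ {D F : FreeCommAlgCat k} (ψ : D ⟶ F) (d : D.Carrier),
    toAlgHom (eqToHom (obj_eq D).symm ≫ (functor Φ).map ψ ≫ eqToHom (obj_eq F)) d =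
      s F (toAlgHom ψ ((s D).symm d))
  map_gen : ∀ (A : FreeCommAlgCat k) (x : A.gens),
    s A (FreeCommNAAlgebra.gen k x) = FreeCommNAAlgebra.gen k x

/-- Strongly stable automorphisms. -/
def IsStronglyStable {k : Type*} [Field k] (Φ : Autos k) : Prop :=
  ∃ s : ∀ A : FreeCommAlgCat k, A.Carrier ≃ A.Carrier, IsInducedBy Φ s

/-- The bijection `s` is an isomorphism from `F` onto the algebra `F*` with the same elements and
the same addition, in which the multiplication by the scalar `c` is `f ↦ φ(c) f` and the product
of `f` and `g` is `α (f g)`. -/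
structure IsTwistIso {k : Type*} [Field k] (φ : RingAut k) (α : kˣ) {A : FreeCommAlgCat k}
    (s : A.Carrier ≃ A.Carrier) : Prop where
  map_add : ∀ f g : A.Carrier, s (f + g) = s f + s g
  map_smul : ∀ (c : k) (f : A.Carrier), s (c • f) = φ c • s f
  map_mul : ∀ f g : A.Carrier, s (f * g) = (α : k) • (s f * s g)

/-- The strongly stable automorphism `Φ` comes from twisting the scalars by `φ` and rescaling the
multiplication by `α`. -/
def IsTwist {k : Type*} [Field k] (Φ : Autos k) (φ : RingAut k) (α : kˣ) : Prop :=
  ∃ s : ∀ A : FreeCommAlgCat k, A.Carrier ≃ A.Carrier,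
    IsInducedBy Φ s ∧ ∀ A, IsTwistIso φ α (s A)

end FreeCommAlgCat

/-!
Let `s` be the bijections by which a strongly stable automorphism acts. Homomorphisms out of a free
algebra are substitutions of elements `f` for the generators, and since `s` fixes the generators,
conjugation by `s` turns this substitution into the one of the elements `s(f)`. On one generator,
the elements whose substitution is invertible are the `c x` with `c ≠ 0`; hence
`s(c f) = φ(c) s(f)` for a multiplicative bijection `φ` of `k`. The elements of a given multidegree
are eigenvectors of the substitutions `x ↦ c ^ w(x) x`, so `s` preserves multidegrees because `k` is
infinite. Thus `s(x + y)` is linear and `s(x y)` is a multiple `α x y`; substituting for `x` and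
`y` shows that `s` is additive, that `φ` is a field automorphism, and that `s(f g) = α s(f) s(g)`.

An arbitrary automorphism fixes the free algebra on one generator up to isomorphism: that object is
a retract of every free algebra with a generator, and retracts have no more generators than the
object they come from. It therefore fixes all finite coproducts of that object, that is, all
objects, up to isomorphism, and is isomorphic to a strongly stable one, as the free algebra on one
generator represents the forgetful functor. The type `(1, α)` is inner by multiplication of the
generators with `α⁻¹`. Conversely, the automorphisms of the free algebra on `x` are the maps
`x ↦ a x`, which commute with `x ↦ c x`, so that an inner automorphism has `φ = 1`.
-/

/-- The module underlying `A`, with the product `f ∘ g = T (f * g)`. For a projection `T` it serves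
as a target of homomorphisms that kill a given element of a free algebra. -/
def PostcompMul {R A : Type*} [CommRing R] [NonUnitalNonAssocCommRing A] [Module R A]
    (_ : A →ₗ[R] A) : Type _ :=
  A

namespace PostcompMul

variable {R A : Type*} [CommRing R] [NonUnitalNonAssocCommRing A] [Module R A] {T : A →ₗ[R] A}

instance : AddCommGroup (PostcompMul T) :=
  inferInstanceAs (AddCommGroup A)

instance : Module R (PostcompMul T) :=
  inferInstanceAs (Module R A)

/-- The identity map from `A` to `A` with the new product. -/
def of (T : A →ₗ[R] A) : A ≃ₗ[R] PostcompMul T :=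
  LinearEquiv.refl R A

instance : Mul (PostcompMul T) :=
  ⟨fun f g => of T (T ((of T).symm f * (of T).symm g))⟩

theorem mul_def (f g : PostcompMul T) : f * g = of T (T ((of T).symm f * (of T).symm g)) :=
  rfl

theorem of_mul_of (f g : A) : of T f * of T g = of T (T (f * g)) :=
  rfl

instance : NonUnitalNonAssocCommRing (PostcompMul T) where
  left_distrib f g h := by simp only [mul_def, map_add, mul_add]
  right_distrib f g h := by simp only [mul_def, map_add, add_mul]
  zero_mul f := by simp only [mul_def, map_zero, zero_mul]
  mul_zero f := by simp only [mul_def, map_zero, mul_zero]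
  mul_comm f g := by simp only [mul_def, mul_comm]

instance [IsScalarTower R A A] : IsScalarTower R (PostcompMul T) (PostcompMul T) where
  smul_assoc c f g := by simp only [smul_eq_mul, mul_def, map_smul, smul_mul_assoc]

instance [SMulCommClass R A A] : SMulCommClass R (PostcompMul T) (PostcompMul T) where
  smul_comm c f g := by simp only [smul_eq_mul, mul_def, map_smul, mul_smul_comm]

end PostcompMul

namespace FreeCommMagma

variable {X : Type*}

instance : CommMagma (FreeCommMagma X) where
  mul_comm := FreeCommNAAlgebra.magma_mul_comm

/-- The generator of the free commutative magma attached to `x`. -/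
def of (x : X) : FreeCommMagma X :=
  (FreeMagma.of x : FreeMagma X)

@[elab_as_elim]
theorem induction {p : FreeCommMagma X → Prop} (of : ∀ x, p (of x))
    (mul : ∀ a b, p a → p b → p (a * b)) (m : FreeCommMagma X) : p m := by
  induction m using Con.induction_on with | H m
  induction m using FreeMagma.recOnMul with
  | ih1 x => exact of x
  | ih2 a b ha hb => exact mul _ _ ha hb

theorem eq_of_or_eq_mul (m : FreeCommMagma X) : (∃ x, m = of x) ∨ ∃ a b, m = a * b := by
  induction m using induction with
  | of x => exact .inl ⟨x, rfl⟩
  | mul a b => exact .inr ⟨a, b, rfl⟩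

section Lift

variable {N : Type*} [CommMagma N]

theorem con_le_ker_lift (f : X → N) : freeCommMagmaCon X ≤ Con.ker (FreeMagma.lift f) := by
  refine Con.conGen_le.2 ?_
  rintro _ _ ⟨u, v, rfl, rfl⟩
  simp only [Con.ker_rel, map_mul, mul_comm]

/-- The homomorphism to a commutative magma extending a map on the generators. -/
def lift (f : X → N) : FreeCommMagma X →ₙ* N where
  toFun a := Con.liftOn a (FreeMagma.lift f) fun _ _ h => con_le_ker_lift f h
  map_mul' a b := by
    induction a, b using Con.induction_on₂ with
    | H a b => exact map_mul (FreeMagma.lift f) a b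

@[simp]
theorem lift_of (f : X → N) (x : X) : lift f (of x) = f x :=
  rfl

end Lift

/-- The weight of a monomial, its generators having the weights `w`. -/
def weight (w : X → ℕ) (m : FreeCommMagma X) : ℕ :=
  (lift (fun x => Multiplicative.ofAdd (w x)) m).toAdd

@[simp]
theorem weight_of (w : X → ℕ) (x : X) : weight w (of x) = w x :=
  rfl

@[simp]
theorem weight_mul (w : X → ℕ) (a b : FreeCommMagma X) :
    weight w (a * b) = weight w a + weight w b := by
  simp only [weight, map_mul, toAdd_mul]

theorem lift_pow {M : Type*} [CommMonoid M] (c : M) (w : X → ℕ) (m : FreeCommMagma X) :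
    lift (fun x => c ^ w x) m = c ^ weight w m := by
  induction m using induction with
  | of x => rw [lift_of, weight_of]
  | mul a b ha hb => rw [map_mul, weight_mul, pow_add, ha, hb]

theorem of_injective : Function.Injective (of : X → FreeCommMagma X) := by
  classical
  intro x y h
  have hw := congrArg (weight (Pi.single x 1)) h
  rw [weight_of, weight_of, Pi.single_eq_same, Pi.single_apply] at hw
  by_contra hne
  exact one_ne_zero (hw.trans (if_neg (Ne.symm hne)))

/-- The number of factors of a monomial. -/
abbrev length (m : FreeCommMagma X) : ℕ :=
  weight 1 m

theorem length_of (x : X) : length (of x) = 1 :=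
  rfl

theorem length_mul (a b : FreeCommMagma X) : length (a * b) = length a + length b :=
  weight_mul 1 a b

theorem length_pos (m : FreeCommMagma X) : 0 < length m := by
  induction m using induction with
  | of _ => exact Nat.one_pos
  | mul a b ha => rw [length_mul]; exact Nat.add_pos_left ha _

theorem exists_eq_of_of_length_eq_one {m : FreeCommMagma X} (h : length m = 1) :
    ∃ x, m = of x := by
  refine (eq_of_or_eq_mul m).resolve_right ?_
  rintro ⟨a, b, rfl⟩
  have := length_mul a b
  have := length_pos a
  have := length_pos b
  omega

theorem exists_eq_of_mul_of_of_length_eq_two {m : FreeCommMagma X} (h : length m = 2) :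
    ∃ x y, m = of x * of y := by
  rcases eq_of_or_eq_mul m with ⟨x, rfl⟩ | ⟨a, b, rfl⟩
  · simp at h
  · have hab := length_mul a b
    have ha := length_pos a
    have hb := length_pos b
    obtain ⟨x, rfl⟩ := exists_eq_of_of_length_eq_one (m := a) (by omega)
    obtain ⟨y, rfl⟩ := exists_eq_of_of_length_eq_one (m := b) (by omega)
    exact ⟨x, y, rfl⟩

theorem of_mul_ne_of (a b : FreeCommMagma X) (x : X) : a * b ≠ of x := by
  intro h
  have hab := length_mul a b
  rw [h, length_of] at hab
  have := length_pos a
  have := length_pos b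
  omega

end FreeCommMagma

namespace FreeCommNAAlgebra

open FreeCommMagma (of weight length length_pos length_of length_mul)

variable {k : Type*} [Field k] {X Y : Type*}

noncomputable instance : NonUnitalNonAssocCommRing (FreeCommNAAlgebra k X) where
  mul_comm := mul_comm' k

section Lift

variable {A : Type*} [NonUnitalNonAssocCommRing A] [Module k A] [IsScalarTower k A A]
  [SMulCommClass k A A]

/-- The algebra homomorphism extending a map on the generators. -/
noncomputable def lift (f : X → A) : FreeCommNAAlgebra k X →ₙₐ[k] A :=
  (existsUnique_lift k f).choose

@[simp]
theorem lift_gen (f : X → A) (x : X) : lift f (gen k x) = f x :=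
  (existsUnique_lift k f).choose_spec.1 x

theorem hom_ext {F G : FreeCommNAAlgebra k X →ₙₐ[k] A} (h : ∀ x, F (gen k x) = G (gen k x)) :
    F = G :=
  (existsUnique_lift k fun x => G (gen k x)).unique h fun _ => rfl

end Lift

section Basis

/-- The basis vector given by the monomial `m`. -/
noncomputable abbrev monomial (k : Type*) [Field k] {X : Type*} (m : FreeCommMagma X) :
    FreeCommNAAlgebra k X :=
  MonoidAlgebra.single m 1

theorem gen_eq_monomial (x : X) : gen k x = monomial k (of x) :=
  rfl

theorem monomial_mul (a b : FreeCommMagma X) :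
    monomial k (a * b) = monomial k a * monomial k b := by
  rw [MonoidAlgebra.single_mul_single, mul_one]

theorem monomial_ne_zero (m : FreeCommMagma X) : monomial k m ≠ 0 := by
  simp

theorem gen_ne_zero (x : X) : gen k x ≠ 0 :=
  monomial_ne_zero _

theorem gen_mul_gen_ne_zero (x y : X) : gen k x * gen k y ≠ 0 := by
  rw [gen_eq_monomial, gen_eq_monomial, ← monomial_mul]
  exact monomial_ne_zero _

theorem smul_gen_injective (x : X) : Function.Injective fun c : k => c • gen k x :=
  smul_left_injective k (gen_ne_zero x)

theorem coeff_gen [DecidableEq X] (x y : X) :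
    (gen k x).coeff (of y) = if x = y then 1 else 0 := by
  classical
  simp [gen_eq_monomial, Finsupp.single_apply, FreeCommMagma.of_injective.eq_iff]

theorem sum_coeff_smul_monomial {f : FreeCommNAAlgebra k X} {s : Finset (FreeCommMagma X)}
    (hs : ∀ m, f.coeff m ≠ 0 → m ∈ s) : ∑ m ∈ s, f.coeff m • monomial k m = f := by
  conv_rhs => rw [← MonoidAlgebra.sum_coeff_single f,
    Finsupp.sum_of_support_subset _ (fun m hm => hs m (Finsupp.mem_support_iff.1 hm)) _
      fun _ _ => MonoidAlgebra.single_zero _]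
  simp only [MonoidAlgebra.smul_single, smul_eq_mul, mul_one]

theorem map_eq_map_of_forall_monomial {M F G : Type*} [AddCommMonoid M] [Module k M]
    [FunLike F (FreeCommNAAlgebra k X) M] [LinearMapClass F k (FreeCommNAAlgebra k X) M]
    [FunLike G (FreeCommNAAlgebra k X) M] [LinearMapClass G k (FreeCommNAAlgebra k X) M]
    {S : F} {T : G} {f : FreeCommNAAlgebra k X}
    (h : ∀ m, f.coeff m ≠ 0 → S (monomial k m) = T (monomial k m)) : S f = T f := by
  rw [← sum_coeff_smul_monomial (f := f) fun m hm => Finsupp.mem_support_iff.2 hm, map_sum,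
    map_sum]
  refine Finset.sum_congr rfl fun m hm => ?_
  rw [map_smul, map_smul, h m (Finsupp.mem_support_iff.1 hm)]

@[elab_as_elim]
theorem induction {p : FreeCommNAAlgebra k X → Prop} (zero : p 0) (gen : ∀ x, p (gen k x))
    (add : ∀ f g, p f → p g → p (f + g)) (smul : ∀ (c : k) f, p f → p (c • f))
    (mul : ∀ f g, p f → p g → p (f * g)) (f : FreeCommNAAlgebra k X) : p f := by
  have monomial (m : FreeCommMagma X) : p (monomial k m) := by
    induction m using FreeCommMagma.induction with
    | of x => exact gen x
    | mul a b ha hb => exact monomial_mul (k := k) a b ▸ mul _ _ ha hb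
  induction f using MonoidAlgebra.induction_linear with
  | zero => exact zero
  | add f g hf hg => exact add f g hf hg
  | single m r =>
    have hr := smul r _ (monomial m)
    rwa [MonoidAlgebra.smul_single, smul_eq_mul, mul_one] at hr

/-- The linear functional that takes the coefficient of the monomial `m`. -/
noncomputable def lcoeff (m : FreeCommMagma X) : FreeCommNAAlgebra k X →ₗ[k] k :=
  Finsupp.lapply m ∘ₗ (MonoidAlgebra.coeffLinearEquiv k).toLinearMap

@[simp]
theorem lcoeff_apply (m : FreeCommMagma X) (f : FreeCommNAAlgebra k X) :
    lcoeff m f = f.coeff m :=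
  rfl

theorem coeff_sum_smul_gen [Fintype X] (a : X → k) (y : X) :
    (∑ x, a x • gen k x).coeff (of y) = a y := by
  classical
  change lcoeff (of y) _ = _
  simp [coeff_gen]

theorem subsingleton_of_isEmpty [IsEmpty X] : Subsingleton (FreeCommNAAlgebra k X) := by
  have : IsEmpty (FreeCommMagma X) := ⟨fun m => by
    induction m using FreeCommMagma.induction with
    | of x => exact isEmptyElim x
    | mul _ _ ha => exact ha⟩
  exact MonoidAlgebra.coeff_injective.subsingleton

end Basis

section Rescale

/-- The endomorphism that multiplies each generator `x` by `a x`. -/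
noncomputable def rescale (a : X → k) : FreeCommNAAlgebra k X →ₙₐ[k] FreeCommNAAlgebra k X :=
  lift fun x => a x • gen k x

@[simp]
theorem rescale_gen (a : X → k) (x : X) : rescale a (gen k x) = a x • gen k x :=
  lift_gen _ x

theorem rescale_monomial (a : X → k) (m : FreeCommMagma X) :
    rescale a (monomial k m) = FreeCommMagma.lift a m • monomial k m := by
  induction m using FreeCommMagma.induction with
  | of x => exact rescale_gen a x
  | mul u v hu hv => rw [monomial_mul, map_mul, hu, hv, map_mul, smul_mul_smul_comm]

theorem coeff_rescale (a : X → k) (f : FreeCommNAAlgebra k X) (m : FreeCommMagma X) :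
    (rescale a f).coeff m = FreeCommMagma.lift a m * f.coeff m := by
  classical
  refine map_eq_map_of_forall_monomial (S := lcoeff m ∘ₗ (rescale a : _ →ₗ[k] _))
    (T := FreeCommMagma.lift a m • lcoeff m) fun n _ => ?_
  change lcoeff m (rescale a (monomial k n)) = _
  rw [rescale_monomial]
  by_cases h : n = m
  · simp [h]
  · simp [Finsupp.single_eq_of_ne' h]

theorem rescale_inv_rescale (a : X → kˣ) (f : FreeCommNAAlgebra k X) :
    rescale (fun x => (↑(a x)⁻¹ : k)) (rescale (fun x => (a x : k)) f) = f := by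
  have h : (rescale fun x => (↑(a x)⁻¹ : k)).comp (rescale fun x => (a x : k)) =
      NonUnitalAlgHom.id k (FreeCommNAAlgebra k X) :=
    hom_ext fun x => by simp [smul_smul]
  exact DFunLike.congr_fun h f

theorem rescale_rescale_inv (a : X → kˣ) (f : FreeCommNAAlgebra k X) :
    rescale (fun x => (a x : k)) (rescale (fun x => (↑(a x)⁻¹ : k)) f) = f := by
  simpa only [Pi.inv_apply, inv_inv] using rescale_inv_rescale a⁻¹ f

end Rescale

section MapScalars

/-- The additive automorphism that applies `φ` to the coefficients. -/
noncomputable def mapScalars (φ : RingAut k) : FreeCommNAAlgebra k X ≃+ FreeCommNAAlgebra k X :=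
  MonoidAlgebra.mapAddEquiv (FreeCommMagma X) φ.toAddEquiv

theorem mapScalars_single (φ : RingAut k) (m : FreeCommMagma X) (r : k) :
    mapScalars φ (MonoidAlgebra.single m r) = MonoidAlgebra.single m (φ r) :=
  MonoidAlgebra.mapAddEquiv_single _ _ _

theorem mapScalars_gen (φ : RingAut k) (x : X) : mapScalars φ (gen k x) = gen k x := by
  rw [gen_eq_monomial, mapScalars_single, map_one]

theorem mapScalars_smul (φ : RingAut k) (c : k) (f : FreeCommNAAlgebra k X) :
    mapScalars φ (c • f) = φ c • mapScalars φ f := by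
  induction f using MonoidAlgebra.induction_linear with
  | zero => simp only [smul_zero, map_zero]
  | add f g hf hg => rw [smul_add, map_add, hf, hg, map_add, smul_add]
  | single m r =>
    rw [MonoidAlgebra.smul_single, mapScalars_single, mapScalars_single,
      MonoidAlgebra.smul_single, smul_eq_mul, smul_eq_mul, map_mul]

theorem mapScalars_mul (φ : RingAut k) (f g : FreeCommNAAlgebra k X) :
    mapScalars φ (f * g) = mapScalars φ f * mapScalars φ g := by
  induction f using MonoidAlgebra.induction_linear with
  | zero => simp only [zero_mul, map_zero]
  | add f f' hf hf' => rw [add_mul, map_add, hf, hf', map_add, add_mul]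
  | single m r =>
    induction g using MonoidAlgebra.induction_linear with
    | zero => simp only [mul_zero, map_zero]
    | add g g' hg hg' => rw [mul_add, map_add, hg, hg', map_add, mul_add]
    | single n t =>
      rw [MonoidAlgebra.single_mul_single, mapScalars_single, mapScalars_single,
        mapScalars_single, MonoidAlgebra.single_mul_single, map_mul]

end MapScalars

section Homogeneous

/-- All monomials of `f` have weight `n`, the generators having the weights `w`. -/
def IsHomogeneous (w : X → ℕ) (n : ℕ) (f : FreeCommNAAlgebra k X) : Prop :=
  ∀ ⦃m⦄, f.coeff m ≠ 0 → weight w m = n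

theorem isHomogeneous_monomial (w : X → ℕ) (m : FreeCommMagma X) :
    IsHomogeneous w (weight w m) (monomial k m) := by
  intro n hn
  contrapose! hn
  exact Finsupp.single_eq_of_ne (ne_of_apply_ne (weight w) hn)

theorem isHomogeneous_gen (w : X → ℕ) (x : X) : IsHomogeneous w (w x) (gen k x) :=
  isHomogeneous_monomial w (of x)

theorem isHomogeneous_gen_mul_gen (w : X → ℕ) (x y : X) :
    IsHomogeneous w (w x + w y) (gen k x * gen k y) := by
  rw [gen_eq_monomial, gen_eq_monomial, ← monomial_mul]
  exact isHomogeneous_monomial w (of x * of y)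

theorem IsHomogeneous.add {w : X → ℕ} {n : ℕ} {f g : FreeCommNAAlgebra k X}
    (hf : IsHomogeneous w n f) (hg : IsHomogeneous w n g) : IsHomogeneous w n (f + g) := by
  intro m hm
  by_contra hne
  refine hm ?_
  rw [MonoidAlgebra.coeff_add, Finsupp.add_apply, not_not.1 (mt (@hf m) hne),
    not_not.1 (mt (@hg m) hne), add_zero]

theorem IsHomogeneous.rescale_pow {w : X → ℕ} {n : ℕ} {f : FreeCommNAAlgebra k X}
    (hf : IsHomogeneous w n f) (c : k) : rescale (fun x => c ^ w x) f = c ^ n • f := by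
  ext m
  rw [coeff_rescale, FreeCommMagma.lift_pow, MonoidAlgebra.coeff_smul, Finsupp.smul_apply,
    smul_eq_mul]
  by_cases hm : f.coeff m = 0
  · rw [hm, mul_zero, mul_zero]
  · rw [hf hm]

theorem isHomogeneous_of_rescale_pow [Infinite k] {w : X → ℕ} {n : ℕ}
    {f : FreeCommNAAlgebra k X} (h : ∀ c : k, rescale (fun x => c ^ w x) f = c ^ n • f) :
    IsHomogeneous w n f := by
  intro m hm
  have hpow (c : k) : c ^ weight w m = c ^ n := by
    have hc := coeff_rescale (fun x => c ^ w x) f m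
    rw [h, FreeCommMagma.lift_pow, MonoidAlgebra.coeff_smul, Finsupp.smul_apply, smul_eq_mul] at hc
    exact (mul_right_cancel₀ hm hc).symm
  have hX : (Polynomial.X ^ weight w m : Polynomial k) = Polynomial.X ^ n :=
    Polynomial.funext fun c => by rw [Polynomial.eval_X_pow, Polynomial.eval_X_pow, hpow]
  simpa only [Polynomial.natDegree_X_pow] using congrArg Polynomial.natDegree hX

theorem IsHomogeneous.sum_coeff_smul_gen [Fintype X] {f : FreeCommNAAlgebra k X}
    (hf : IsHomogeneous 1 1 f) : ∑ x, f.coeff (of x) • gen k x = f := by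
  have hs (m) (hm : f.coeff m ≠ 0) :
      m ∈ Finset.univ.map ⟨of, FreeCommMagma.of_injective⟩ := by
    obtain ⟨x, rfl⟩ := FreeCommMagma.exists_eq_of_of_length_eq_one (hf hm)
    exact Finset.mem_map_of_mem _ (Finset.mem_univ x)
  exact (Finset.sum_map _ _ _).symm.trans (sum_coeff_smul_monomial hs)

end Homogeneous

section PostcompMul

variable {T : FreeCommNAAlgebra k X →ₗ[k] FreeCommNAAlgebra k X} {n : ℕ}

theorem lift_postcompMul_monomial (hT : ∀ m, length m < n → T (monomial k m) = monomial k m)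
    {m : FreeCommMagma X} (hm : length m ≤ n) :
    lift (fun x => PostcompMul.of T (T (gen k x))) (monomial k m) =
      PostcompMul.of T (T (monomial k m)) := by
  induction m using FreeCommMagma.induction with
  | of x => exact lift_gen _ x
  | mul a b ha hb =>
    have ha_pos := length_pos a
    have hb_pos := length_pos b
    rw [length_mul] at hm
    rw [monomial_mul, map_mul, ha (by omega), hb (by omega), hT a (by omega), hT b (by omega),
      PostcompMul.of_mul_of]

theorem lift_postcompMul_apply (hT : ∀ m, length m < n → T (monomial k m) = monomial k m)
    {f : FreeCommNAAlgebra k X} (hf : ∀ m, f.coeff m ≠ 0 → length m ≤ n) :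
    lift (fun x => PostcompMul.of T (T (gen k x))) f = PostcompMul.of T (T f) :=
  map_eq_map_of_forall_monomial (T := (PostcompMul.of T).toLinearMap ∘ₗ T) fun m hm =>
    lift_postcompMul_monomial hT (hf m hm)

/-- If `v` had a longest monomial `m₀` of length at least `2`, the projection `T` along `v` onto
the elements without `m₀` would fix all shorter monomials; the homomorphism to `PostcompMul T` that
fixes the generators would then kill `v`, hence all that `v` generates, but not `gen k x`. -/
theorem isHomogeneous_one_of_lift_const_eq_gen {u : FreeCommNAAlgebra k Y}
    {v : FreeCommNAAlgebra k X} {x : X} (h : lift (fun _ => v) u = gen k x) :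
    IsHomogeneous 1 1 v := by
  intro m hm
  by_contra hne
  obtain ⟨m₀, hm₀, hmax⟩ :=
    v.coeff.support.exists_max_image length ⟨m, Finsupp.mem_support_iff.2 hm⟩
  have hv₀ : v.coeff m₀ ≠ 0 := Finsupp.mem_support_iff.1 hm₀
  have hlong : 1 < length m₀ :=
    lt_of_lt_of_le (lt_of_le_of_ne (length_pos m) (Ne.symm hne))
      (hmax m (Finsupp.mem_support_iff.2 hm))
  let T := LinearMap.id - ((v.coeff m₀)⁻¹ • lcoeff m₀).smulRight v
  have hT (m) (hm : length m < length m₀) : T (monomial k m) = monomial k m := by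
    have hmm₀ : lcoeff m₀ (monomial k m) = 0 :=
      Finsupp.single_eq_of_ne (ne_of_apply_ne length hm.ne')
    simp only [T, LinearMap.sub_apply, LinearMap.id_apply, LinearMap.smulRight_apply,
      LinearMap.smul_apply, hmm₀, smul_zero, zero_smul, sub_zero]
  have hTv : T v = 0 := by simp [T, hv₀]
  let F : FreeCommNAAlgebra k X →ₙₐ[k] PostcompMul T :=
    lift fun y => PostcompMul.of T (T (gen k y))
  have hFv : F v = 0 := by
    rw [lift_postcompMul_apply hT fun m hm => hmax m (Finsupp.mem_support_iff.2 hm), hTv, map_zero]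
  have hF : F.comp (lift fun _ : Y => v) = 0 :=
    hom_ext fun y => by rw [NonUnitalAlgHom.comp_apply, lift_gen, hFv, NonUnitalAlgHom.zero_apply]
  have hFx : PostcompMul.of T (gen k x) = 0 := calc
    PostcompMul.of T (gen k x) = F (gen k x) := by rw [lift_gen, gen_eq_monomial, hT (of x) hlong]
    _ = F.comp (lift fun _ => v) u := by rw [NonUnitalAlgHom.comp_apply, h]
    _ = 0 := by rw [hF, NonUnitalAlgHom.zero_apply]
  exact gen_ne_zero x ((map_eq_zero_iff _ (PostcompMul.of T).injective).1 hFx)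

end PostcompMul

section LinearPart

theorem coeff_mul_of (f g : FreeCommNAAlgebra k X) (x : X) : (f * g).coeff (of x) = 0 := by
  induction f using MonoidAlgebra.induction_linear with
  | zero => simp
  | add f f' h h' => rw [add_mul]; simp [h, h']
  | single a r =>
    induction g using MonoidAlgebra.induction_linear with
    | zero => simp
    | add f f' h h' => rw [mul_add]; simp [h, h']
    | single b s =>
      rw [MonoidAlgebra.single_mul_single]
      exact Finsupp.single_eq_of_ne (FreeCommMagma.of_mul_ne_of a b x).symm

theorem coeff_of_map [Fintype X] (F : FreeCommNAAlgebra k X →ₙₐ[k] FreeCommNAAlgebra k Y)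
    (f : FreeCommNAAlgebra k X) (y : Y) :
    (F f).coeff (of y) = ∑ x, f.coeff (of x) * (F (gen k x)).coeff (of y) := by
  classical
  have h := map_eq_map_of_forall_monomial (f := f)
    (S := lcoeff (of y) ∘ₗ (F : FreeCommNAAlgebra k X →ₗ[k] FreeCommNAAlgebra k Y))
    (T := ∑ x, (F (gen k x)).coeff (of y) • lcoeff (of x)) fun m _ => by
      rcases FreeCommMagma.eq_of_or_eq_mul m with ⟨z, rfl⟩ | ⟨a, b, rfl⟩
      · simp [← gen_eq_monomial, coeff_gen]
      · simp only [monomial_mul]; simp [-MonoidAlgebra.single_mul_single, coeff_mul_of]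
  simpa [mul_comm] using h

theorem card_le_of_surjective [Fintype X] [Fintype Y]
    {F : FreeCommNAAlgebra k X →ₙₐ[k] FreeCommNAAlgebra k Y} (hF : Function.Surjective F) :
    Fintype.card Y ≤ Fintype.card X := by
  classical
  refine _root_.card_le_of_surjective k
    (Matrix.vecMulLinear fun x y => (F (gen k x)).coeff (of y)) fun b => ?_
  obtain ⟨f, hf⟩ := hF (∑ y, b y • gen k y)
  refine ⟨fun x => f.coeff (of x), funext fun y => ?_⟩
  rw [← coeff_sum_smul_gen b y, ← hf, coeff_of_map]
  rfl

end LinearPart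

end FreeCommNAAlgebra

namespace FreeCommAlgCat

open FreeCommNAAlgebra

variable {k : Type*} [Field k]

section FreeObjects

/-- The free algebra on no generators. -/
abbrev zero (k : Type*) [Field k] : FreeCommAlgCat k :=
  ⟨∅⟩

/-- The free algebra on one generator. -/
abbrev one (k : Type*) [Field k] : FreeCommAlgCat k :=
  ⟨{0}⟩

/-- The free algebra on two generators. -/
abbrev two (k : Type*) [Field k] : FreeCommAlgCat k :=
  ⟨{0, 1}⟩

/-- The first generator of `two k`. -/
def fst : (two k).gens :=
  ⟨0, Finset.mem_insert_self _ _⟩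

/-- The second generator of `two k`. -/
def snd : (two k).gens :=
  ⟨1, Finset.mem_insert_of_mem (Finset.mem_singleton_self _)⟩

theorem eq_fst_or_eq_snd : ∀ x : (two k).gens, x = fst ∨ x = snd := by
  rintro ⟨x, hx⟩
  simpa [fst, snd] using hx

theorem fst_ne_snd : (fst : (two k).gens) ≠ snd :=
  Subtype.coe_ne_coe.1 zero_ne_one

theorem sum_gens_two {M : Type*} [AddCommMonoid M] (f : (two k).gens → M) :
    ∑ x, f x = f fst + f snd :=
  Fintype.sum_eq_add _ _ fst_ne_snd fun x hx => absurd (eq_fst_or_eq_snd x) (not_or.2 hx)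

/-- The family indexed by the two generators of `two k` with the given values. -/
def pair {M : Type*} (f g : M) (x : (two k).gens) : M :=
  if x = fst then f else g

@[simp]
theorem pair_fst {M : Type*} (f g : M) : pair f g (fst : (two k).gens) = f :=
  if_pos rfl

@[simp]
theorem pair_snd {M : Type*} (f g : M) : pair f g (snd : (two k).gens) = g :=
  if_neg fst_ne_snd.symm

theorem eq_of_fst_mul_of_snd {m : FreeCommMagma (two k).gens} (hlength : m.length = 2)
    (hweight : m.weight (pair 1 0) = 1) : m = .of fst * .of snd := by
  obtain ⟨x, y, rfl⟩ := FreeCommMagma.exists_eq_of_mul_of_of_length_eq_two hlength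
  rcases eq_fst_or_eq_snd x with rfl | rfl <;> rcases eq_fst_or_eq_snd y with rfl | rfl
  · simp at hweight
  · rfl
  · exact mul_comm _ _
  · simp at hweight

instance subsingleton_carrier_zero : Subsingleton (zero k).Carrier :=
  subsingleton_of_isEmpty

end FreeObjects

/-- Conjugation by the bijections `s` is a bijection of each set of homomorphisms. -/
structure PreservesHoms (s : ∀ A : FreeCommAlgCat k, A.Carrier ≃ A.Carrier) : Prop where
  exists_conj : ∀ {D F : FreeCommAlgCat k} (ψ : D.Carrier →ₙₐ[k] F.Carrier),
    ∃ χ : D.Carrier →ₙₐ[k] F.Carrier, ∀ d, χ (s D d) = s F (ψ d)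
  exists_conj_symm : ∀ {D F : FreeCommAlgCat k} (χ : D.Carrier →ₙₐ[k] F.Carrier),
    ∃ ψ : D.Carrier →ₙₐ[k] F.Carrier, ∀ d, χ (s D d) = s F (ψ d)

/-- The bijections `s` fix the free generators. -/
def FixesGens (s : ∀ A : FreeCommAlgCat k, A.Carrier ≃ A.Carrier) : Prop :=
  ∀ (A : FreeCommAlgCat k) (x : A.gens), s A (gen k x) = gen k x

section PreservesHoms

variable {s : ∀ A : FreeCommAlgCat k, A.Carrier ≃ A.Carrier}

theorem PreservesHoms.symm (hs : PreservesHoms s) : PreservesHoms fun A => (s A).symm where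
  exists_conj {D F} χ := by
    obtain ⟨ψ, hψ⟩ := hs.exists_conj_symm χ
    exact ⟨ψ, fun d => by rw [Equiv.eq_symm_apply, ← hψ, Equiv.apply_symm_apply]⟩
  exists_conj_symm {D F} ψ := by
    obtain ⟨χ, hχ⟩ := hs.exists_conj ψ
    exact ⟨χ, fun d => by rw [Equiv.eq_symm_apply, ← hχ, Equiv.apply_symm_apply]⟩

theorem FixesGens.symm (hg : FixesGens s) : FixesGens fun A => (s A).symm :=
  fun A x => (Equiv.symm_apply_eq _).2 (hg A x).symm

theorem PreservesHoms.map_lift (hs : PreservesHoms s) (hg : FixesGens s) {D F : FreeCommAlgCat k}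
    (f : D.gens → F.Carrier) (d : D.Carrier) :
    s F (lift f d) = lift (fun x => s F (f x)) (s D d) := by
  obtain ⟨χ, hχ⟩ := hs.exists_conj (lift f)
  have hlift : χ = lift fun x => s F (f x) := hom_ext fun x => by
    rw [lift_gen, ← hg, hχ, lift_gen]
  rw [← hχ, hlift]

theorem PreservesHoms.map_zero (hs : PreservesHoms s) (F : FreeCommAlgCat k) : s F 0 = 0 := by
  obtain ⟨χ, hχ⟩ := hs.exists_conj (0 : (zero k).Carrier →ₙₐ[k] F.Carrier)
  calc s F 0 = χ (s (zero k) 0) := by rw [hχ, NonUnitalAlgHom.zero_apply]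
    _ = 0 := by rw [Subsingleton.elim (s (zero k) 0) 0, _root_.map_zero]

section Scalars

theorem PreservesHoms.isHomogeneous_map_smul_gen (hs : PreservesHoms s) (hg : FixesGens s)
    (c : k) : IsHomogeneous 1 1 (s (one k) (c • gen k default)) := by
  rcases eq_or_ne c 0 with rfl | hc
  · rw [zero_smul, hs.map_zero]
    exact fun m hm => absurd rfl hm
  · refine isHomogeneous_one_of_lift_const_eq_gen (x := default)
      (u := s (one k) (c⁻¹ • gen k default)) ?_
    rw [← hs.map_lift hg, map_smul, lift_gen, inv_smul_smul₀ hc, hg]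

theorem PreservesHoms.exists_map_smul (hs : PreservesHoms s) (hg : FixesGens s) (c : k) :
    ∃ b : k, ∀ (A : FreeCommAlgCat k) (f : A.Carrier), s A (c • f) = b • s A f := by
  have hb := (hs.isHomogeneous_map_smul_gen hg c).sum_coeff_smul_gen
  rw [Fintype.sum_unique] at hb
  refine ⟨(s (one k) (c • gen k default)).coeff (.of default), fun A f => ?_⟩
  calc s A (c • f) = s A (lift (fun _ : (one k).gens => f) (c • gen k default)) :=
        congrArg (s A) (by rw [map_smul, lift_gen])
    _ = lift (fun _ => s A f) (s (one k) (c • gen k default)) := hs.map_lift hg _ _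
    _ = _ := by rw [← hb, map_smul, lift_gen, hb]

theorem PreservesHoms.exists_mulEquiv (hs : PreservesHoms s) (hg : FixesGens s) :
    ∃ q : k ≃* k, ∀ (A : FreeCommAlgCat k) (c : k) (f : A.Carrier),
      s A (c • f) = q c • s A f := by
  choose q hq using hs.exists_map_smul hg
  choose r hr using hs.symm.exists_map_smul hg.symm
  let x : (one k).Carrier := gen k default
  have hsx (c : k) : s _ (c • x) = q c • x := by rw [hq, hg]
  have hrx (c : k) : (s _).symm (c • x) = r c • x := by rw [hr, hg.symm]
  refine ⟨⟨⟨q, r, fun c => ?_, fun c => ?_⟩, fun c d => ?_⟩, fun A c f => hq c A f⟩ <;>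
    refine smul_gen_injective (default : (one k).gens) ?_
  · change r (q c) • x = c • x
    rw [← hrx, ← hsx, Equiv.symm_apply_apply]
  · change q (r c) • x = c • x
    rw [← hsx, ← hrx, Equiv.apply_symm_apply]
  · change q (c * d) • x = (q c * q d) • x
    rw [← hsx, mul_smul, hq, hsx, mul_smul]

end Scalars

theorem PreservesHoms.isHomogeneous_map [Infinite k] (hs : PreservesHoms s) (hg : FixesGens s)
    {A : FreeCommAlgCat k} {w : A.gens → ℕ} {n : ℕ} {f : A.Carrier} (hf : IsHomogeneous w n f) :
    IsHomogeneous w n (s A f) := by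
  obtain ⟨q, hq⟩ := hs.exists_mulEquiv hg
  refine isHomogeneous_of_rescale_pow fun b => ?_
  obtain ⟨c, rfl⟩ := q.surjective b
  calc rescale (fun x => q c ^ w x) (s A f)
      = lift (fun x => s A (c ^ w x • gen k x)) (s A f) := by
        simp only [hq, hg A, map_pow, rescale]
    _ = s A (rescale (fun x => c ^ w x) f) := (hs.map_lift hg _ _).symm
    _ = q c ^ n • s A f := by rw [hf.rescale_pow, hq, map_pow]

theorem PreservesHoms.map_gen_add_gen [Infinite k] (hs : PreservesHoms s) (hg : FixesGens s) :
    s (two k) (gen k fst + gen k snd) = gen k fst + gen k snd := by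
  set x : (two k).Carrier := gen k fst
  set y : (two k).Carrier := gen k snd
  have hlin : IsHomogeneous 1 1 (s (two k) (x + y)) :=
    hs.isHomogeneous_map hg ((isHomogeneous_gen 1 fst).add (isHomogeneous_gen 1 snd))
  obtain ⟨a, b, hab⟩ : ∃ a b : k, s (two k) (x + y) = a • x + b • y :=
    ⟨_, _, (hlin.sum_coeff_smul_gen.symm.trans (sum_gens_two _))⟩
  have ha : x = a • x := by
    simpa [x, y, hab, hg (two k) _, hs.map_zero] using hs.map_lift hg (pair x 0) (x + y)
  have hb : y = b • y := by
    simpa [x, y, hab, hg (two k) _, hs.map_zero] using hs.map_lift hg (pair 0 y) (x + y)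
  rw [hab, ← ha, ← hb]

theorem PreservesHoms.map_add [Infinite k] (hs : PreservesHoms s) (hg : FixesGens s)
    {A : FreeCommAlgCat k} (f g : A.Carrier) : s A (f + g) = s A f + s A g := by
  have h := hs.map_lift hg (pair f g) (gen k fst + gen k snd)
  simpa only [hs.map_gen_add_gen hg, _root_.map_add, lift_gen, pair_fst, pair_snd] using h

theorem PreservesHoms.exists_map_gen_mul_gen [Infinite k] (hs : PreservesHoms s)
    (hg : FixesGens s) :
    ∃ α : kˣ, s (two k) (gen k fst * gen k snd) = (α : k) • (gen k fst * gen k snd) := by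
  set xy : (two k).Carrier := gen k fst * gen k snd with hxy
  have hlength : IsHomogeneous 1 2 (s _ xy) :=
    hs.isHomogeneous_map hg (isHomogeneous_gen_mul_gen 1 fst snd)
  have hweight : IsHomogeneous (pair 1 0) 1 (s _ xy) :=
    hs.isHomogeneous_map hg (isHomogeneous_gen_mul_gen (pair 1 0) fst snd)
  have hmul := sum_coeff_smul_monomial (s := {.of fst * .of snd}) fun m hm =>
    Finset.mem_singleton.2 (eq_of_fst_mul_of_snd (hlength hm) (hweight hm))
  rw [Finset.sum_singleton, FreeCommNAAlgebra.monomial_mul, ← gen_eq_monomial, ← gen_eq_monomial,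
    ← hxy] at hmul
  refine ⟨Units.mk0 _ fun hα => ?_, hmul.symm⟩
  rw [hα, zero_smul, ← hs.map_zero, (s (two k)).apply_eq_iff_eq] at hmul
  exact gen_mul_gen_ne_zero _ _ hmul.symm

theorem PreservesHoms.exists_map_mul [Infinite k] (hs : PreservesHoms s) (hg : FixesGens s) :
    ∃ α : kˣ, ∀ (A : FreeCommAlgCat k) (f g : A.Carrier),
      s A (f * g) = (α : k) • (s A f * s A g) := by
  obtain ⟨α, hα⟩ := hs.exists_map_gen_mul_gen hg
  refine ⟨α, fun A f g => ?_⟩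
  have h := hs.map_lift hg (pair f g) (gen k fst * gen k snd)
  simpa only [hα, map_smul, map_mul, lift_gen, pair_fst, pair_snd] using h

theorem PreservesHoms.exists_isTwistIso [Infinite k] (hs : PreservesHoms s) (hg : FixesGens s) :
    ∃ (φ : RingAut k) (α : kˣ), ∀ A, IsTwistIso φ α (s A) := by
  obtain ⟨q, hq⟩ := hs.exists_mulEquiv hg
  obtain ⟨α, hα⟩ := hs.exists_map_mul hg
  let x : (one k).Carrier := gen k default
  have hsx (c : k) : s _ (c • x) = q c • x := by rw [hq, hg]
  have hadd (c d : k) : q (c + d) = q c + q d := by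
    refine smul_gen_injective (default : (one k).gens) ?_
    change q (c + d) • x = (q c + q d) • x
    rw [← hsx, add_smul, hs.map_add hg, hsx, hsx, add_smul]
  exact ⟨{ q with map_add' := hadd }, α, fun A => ⟨hs.map_add hg, hq A, hα A⟩⟩

end PreservesHoms

section Morphisms

variable {A B C : FreeCommAlgCat k}

@[simp]
theorem toAlgHom_comp (f : A ⟶ B) (g : B ⟶ C) (a : A.Carrier) :
    toAlgHom (f ≫ g) a = toAlgHom g (toAlgHom f a) :=
  rfl

@[simp]
theorem toAlgHom_id (a : A.Carrier) : toAlgHom (𝟙 A) a = a :=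
  rfl

theorem toAlgHom_ext {f g : A ⟶ B} (h : ∀ a, toAlgHom f a = toAlgHom g a) : f = g :=
  NonUnitalAlgHom.ext h

theorem toAlgHom_ext_gen {f g : A ⟶ B}
    (h : ∀ x, toAlgHom f (gen k x) = toAlgHom g (gen k x)) : f = g :=
  hom_ext h

/-- An algebra homomorphism as a morphism of the category, the inverse of `toAlgHom`. -/
def ofAlgHom (f : A.Carrier →ₙₐ[k] B.Carrier) : A ⟶ B :=
  f

@[simp]
theorem toAlgHom_ofAlgHom (f : A.Carrier →ₙₐ[k] B.Carrier) : toAlgHom (ofAlgHom f) = f :=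
  rfl

/-- The free algebra on one generator represents the forgetful functor: an element `f` of `A`
corresponds to the morphism that takes the generator to `f`. -/
noncomputable def pointEquiv (A : FreeCommAlgCat k) : A.Carrier ≃ (one k ⟶ A) where
  toFun f := ofAlgHom (lift fun _ => f)
  invFun ψ := toAlgHom ψ (gen k default)
  left_inv _ := lift_gen _ _
  right_inv ψ := toAlgHom_ext_gen fun x => by
    rw [Unique.eq_default x, toAlgHom_ofAlgHom, lift_gen]

theorem toAlgHom_pointEquiv_gen (f : A.Carrier) (x : (one k).gens) :
    toAlgHom (pointEquiv A f) (gen k x) = f :=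
  lift_gen _ x

theorem pointEquiv_gen_default : pointEquiv (one k) (gen k default) = 𝟙 (one k) :=
  (pointEquiv (one k)).apply_symm_apply (𝟙 (one k))

theorem pointEquiv_comp (f : A.Carrier) (ψ : A ⟶ B) :
    pointEquiv A f ≫ ψ = pointEquiv B (toAlgHom ψ f) :=
  toAlgHom_ext_gen fun x => by
    rw [toAlgHom_comp, toAlgHom_pointEquiv_gen, toAlgHom_pointEquiv_gen]

end Morphisms

section Autos

theorem autos_ext {Φ Ψ : Autos k} (h : functor Φ = functor Ψ) : Φ = Ψ :=
  Iso.ext (Cat.Hom.ext h)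

theorem functor_comp_inv (Φ : Autos k) : functor Φ ⋙ functor Φ⁻¹ = 𝟭 _ :=
  congrArg Cat.Hom.toFunctor Φ.hom_inv_id

instance isEquivalence_functor (Φ : Autos k) : (functor Φ).IsEquivalence :=
  inferInstanceAs (Cat.equivOfIso Φ).functor.IsEquivalence

end Autos

section Conjugation

variable {s t : ∀ A : FreeCommAlgCat k, A.Carrier ≃ A.Carrier}

theorem PreservesHoms.comp (hs : PreservesHoms s) (ht : PreservesHoms t) :
    PreservesHoms fun A => (t A).trans (s A) where
  exists_conj {D F} ψ := by
    obtain ⟨χ, hχ⟩ := ht.exists_conj ψ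
    obtain ⟨ω, hω⟩ := hs.exists_conj χ
    exact ⟨ω, fun d => by simp only [Equiv.trans_apply, hω, hχ]⟩
  exists_conj_symm {D F} ω := by
    obtain ⟨χ, hχ⟩ := hs.exists_conj_symm ω
    obtain ⟨ψ, hψ⟩ := ht.exists_conj_symm χ
    exact ⟨ψ, fun d => by simp only [Equiv.trans_apply, hχ, hψ]⟩

/-- The conjugate of the morphism `ψ` by the bijections `s`. -/
noncomputable def conj (hs : PreservesHoms s) {D F : FreeCommAlgCat k} (ψ : D ⟶ F) : D ⟶ F :=
  ofAlgHom (hs.exists_conj (toAlgHom ψ)).choose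

theorem conj_apply (hs : PreservesHoms s) {D F : FreeCommAlgCat k} (ψ : D ⟶ F) (d : D.Carrier) :
    toAlgHom (conj hs ψ) (s D d) = s F (toAlgHom ψ d) :=
  (hs.exists_conj (toAlgHom ψ)).choose_spec d

theorem toAlgHom_ext_map {D F : FreeCommAlgCat k} {ψ χ : D ⟶ F}
    (h : ∀ d, toAlgHom ψ (s D d) = toAlgHom χ (s D d)) : ψ = χ :=
  toAlgHom_ext ((s D).surjective.forall.2 h)

/-- The functor that fixes the objects and conjugates the morphisms by the bijections `s`. -/
noncomputable def conjFunctor (hs : PreservesHoms s) : FreeCommAlgCat k ⥤ FreeCommAlgCat k where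
  obj A := A
  map ψ := conj hs ψ
  map_id A := toAlgHom_ext_map (s := s) fun a => by rw [conj_apply, toAlgHom_id, toAlgHom_id]
  map_comp f g := toAlgHom_ext_map (s := s) fun a => by
    rw [toAlgHom_comp, conj_apply, conj_apply, conj_apply, toAlgHom_comp]

theorem conjFunctor_comp_conjFunctor (hs : PreservesHoms s) (ht : PreservesHoms t) :
    conjFunctor ht ⋙ conjFunctor hs = conjFunctor (hs.comp ht) := by
  refine CategoryTheory.Functor.ext (fun _ => rfl) fun D F ψ => ?_
  change conj hs (conj ht ψ) = conj (hs.comp ht) ψ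
  refine toAlgHom_ext_map (s := fun A => (t A).trans (s A)) fun d => ?_
  rw [conj_apply (hs.comp ht)]
  simp only [Equiv.trans_apply, conj_apply]

theorem conjFunctor_eq_id (hs : PreservesHoms s) (h : ∀ A, s A = Equiv.refl _) :
    conjFunctor hs = 𝟭 _ := by
  obtain rfl : s = fun A => Equiv.refl _ := funext h
  exact CategoryTheory.Functor.ext (fun _ => rfl) fun D F ψ => toAlgHom_ext (conj_apply hs ψ)

/-- The automorphism of the category that fixes the objects and conjugates the morphisms by the
bijections `s`. -/
noncomputable def conjAuto (hs : PreservesHoms s) : Autos k where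
  hom := (conjFunctor hs).toCatHom
  inv := (conjFunctor hs.symm).toCatHom
  hom_inv_id := congrArg Functor.toCatHom <|
    (conjFunctor_comp_conjFunctor hs.symm hs).trans <|
      conjFunctor_eq_id _ fun A => (s A).self_trans_symm
  inv_hom_id := congrArg Functor.toCatHom <|
    (conjFunctor_comp_conjFunctor hs hs.symm).trans <|
      conjFunctor_eq_id _ fun A => (s A).symm_trans_self

theorem isInducedBy_conjAuto (hs : PreservesHoms s) (hg : FixesGens s) :
    IsInducedBy (conjAuto hs) s where
  obj_eq _ := rfl
  map_eq {D F} ψ d := by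
    have h := conj_apply hs ψ ((s D).symm d)
    rwa [Equiv.apply_symm_apply] at h
  map_gen := hg

variable {Φ Ψ : Autos k}

theorem IsInducedBy.fixesGens (h : IsInducedBy Φ s) : FixesGens s :=
  h.map_gen

theorem IsInducedBy.toAlgHom_map (h : IsInducedBy Φ s) {D F : FreeCommAlgCat k} (ψ : D ⟶ F)
    (d : D.Carrier) :
    toAlgHom (eqToHom (h.obj_eq D).symm ≫ (functor Φ).map ψ ≫ eqToHom (h.obj_eq F)) (s D d) =
      s F (toAlgHom ψ d) := by
  rw [h.map_eq, Equiv.symm_apply_apply]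

theorem IsInducedBy.preservesHoms (h : IsInducedBy Φ s) : PreservesHoms s where
  exists_conj ψ := ⟨_, h.toAlgHom_map (ofAlgHom ψ)⟩
  exists_conj_symm {D F} χ := by
    obtain ⟨ψ, hψ⟩ := (functor Φ).map_surjective
      (eqToHom (h.obj_eq D) ≫ ofAlgHom χ ≫ eqToHom (h.obj_eq F).symm)
    refine ⟨toAlgHom ψ, fun d => ?_⟩
    rw [← h.toAlgHom_map, hψ]
    simp

theorem IsInducedBy.eq_conjAuto (h : IsInducedBy Φ s) : Φ = conjAuto h.preservesHoms := by
  refine autos_ext (CategoryTheory.Functor.ext h.obj_eq fun D F ψ => ?_)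
  change (functor Φ).map ψ =
    eqToHom (h.obj_eq D) ≫ conj h.preservesHoms ψ ≫ eqToHom (h.obj_eq F).symm
  have hconj : conj h.preservesHoms ψ =
      eqToHom (h.obj_eq D).symm ≫ (functor Φ).map ψ ≫ eqToHom (h.obj_eq F) :=
    toAlgHom_ext_map (s := s) fun d => by rw [conj_apply, h.toAlgHom_map]
  simp [hconj]

theorem IsInducedBy.unique (h : IsInducedBy Φ s) (h' : IsInducedBy Ψ s) : Φ = Ψ :=
  h.eq_conjAuto.trans h'.eq_conjAuto.symm

theorem IsInducedBy.eq_family (h : IsInducedBy Φ s) (h' : IsInducedBy Φ t) : s = t := by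
  funext A
  ext1 f
  have hs := h.toAlgHom_map (pointEquiv A f) (gen k default)
  have ht := h'.toAlgHom_map (pointEquiv A f) (gen k default)
  rw [h.map_gen, toAlgHom_pointEquiv_gen] at hs
  rw [h'.map_gen, toAlgHom_pointEquiv_gen] at ht
  exact hs.symm.trans ht

theorem IsInducedBy.mul (h : IsInducedBy Φ s) (h' : IsInducedBy Ψ t) :
    IsInducedBy (Φ * Ψ) fun A => (t A).trans (s A) := by
  have hmul : Φ * Ψ = conjAuto (h.preservesHoms.comp h'.preservesHoms) :=
    (congrArg₂ _ h.eq_conjAuto h'.eq_conjAuto).trans <|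
      autos_ext (conjFunctor_comp_conjFunctor h.preservesHoms h'.preservesHoms)
  rw [hmul]
  exact isInducedBy_conjAuto _ fun A x => by rw [Equiv.trans_apply, h'.map_gen, h.map_gen]

theorem IsInducedBy.nonempty_iso (h : IsInducedBy Φ s)
    {G : FreeCommAlgCat k ⥤ FreeCommAlgCat k} (η : ∀ A, A ≅ G.obj A)
    (hη : ∀ {D F : FreeCommAlgCat k} (ψ : D ⟶ F) (d : D.Carrier),
      toAlgHom (η F).hom (s F (toAlgHom ψ d)) =
        toAlgHom (G.map ψ) (toAlgHom (η D).hom (s D d))) :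
    Nonempty (functor Φ ≅ G) := by
  rw [h.eq_conjAuto]
  refine ⟨NatIso.ofComponents (F := conjFunctor h.preservesHoms) η fun {D F} ψ => ?_⟩
  change conj h.preservesHoms ψ ≫ (η F).hom = (η D).hom ≫ G.map ψ
  exact toAlgHom_ext_map (s := s) fun d => by
    rw [toAlgHom_comp, conj_apply, hη, toAlgHom_comp]

end Conjugation

section IsTwistIso

variable {A : FreeCommAlgCat k} {φ ψ : RingAut k} {α β : kˣ}

theorem IsTwistIso.map_zero {s : A.Carrier ≃ A.Carrier} (h : IsTwistIso φ α s) : s 0 = 0 := by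
  simpa only [add_zero, left_eq_add] using h.map_add 0 0

theorem IsTwistIso.symm {s : A.Carrier ≃ A.Carrier} (h : IsTwistIso φ α s) :
    IsTwistIso φ⁻¹ (Units.map (φ⁻¹ : RingAut k).toMonoidHom α⁻¹) s.symm where
  map_add f g := by
    rw [Equiv.symm_apply_eq, h.map_add, Equiv.apply_symm_apply, Equiv.apply_symm_apply]
  map_smul c f := by
    rw [Equiv.symm_apply_eq, h.map_smul, Equiv.apply_symm_apply]
    exact congrArg (· • f) (φ.apply_symm_apply c).symm
  map_mul f g := by
    have hα : φ (Units.map (φ⁻¹ : RingAut k).toMonoidHom α⁻¹ : kˣ) = (α⁻¹ : kˣ) :=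
      φ.apply_symm_apply _
    rw [Equiv.symm_apply_eq, h.map_smul, h.map_mul, Equiv.apply_symm_apply,
      Equiv.apply_symm_apply, smul_smul, hα, Units.inv_mul, one_smul]

theorem IsTwistIso.trans {s t : A.Carrier ≃ A.Carrier} (h : IsTwistIso φ α s)
    (h' : IsTwistIso ψ β t) :
    IsTwistIso (φ * ψ) (Units.map (φ : RingAut k).toMonoidHom β * α) (t.trans s) where
  map_add f g := by simp only [Equiv.trans_apply, h'.map_add, h.map_add]
  map_smul c f := by simp only [Equiv.trans_apply, h'.map_smul, h.map_smul, RingAut.mul_apply]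
  map_mul f g := by
    simp only [Equiv.trans_apply, h'.map_mul, h.map_smul, h.map_mul, smul_smul]
    rfl

theorem IsTwistIso.eq_of_gen {s t : A.Carrier ≃ A.Carrier} (h : IsTwistIso φ α s)
    (h' : IsTwistIso φ α t) (hg : ∀ x, s (gen k x) = t (gen k x)) : s = t := by
  ext1 f
  induction f using FreeCommNAAlgebra.induction with
  | zero => rw [h.map_zero, h'.map_zero]
  | gen x => exact hg x
  | add f g hf hg => rw [h.map_add, h'.map_add, hf, hg]
  | smul c f hf => rw [h.map_smul, h'.map_smul, hf]
  | mul f g hf hg => rw [h.map_mul, h'.map_mul, hf, hg]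

variable {s : ∀ A : FreeCommAlgCat k, A.Carrier ≃ A.Carrier}

theorem exists_conj_of_isTwistIso (h : ∀ A, IsTwistIso φ α (s A)) (hg : FixesGens s)
    {D F : FreeCommAlgCat k} (ψ : D.Carrier →ₙₐ[k] F.Carrier) :
    ∃ χ : D.Carrier →ₙₐ[k] F.Carrier, ∀ d, χ (s D d) = s F (ψ d) := by
  refine ⟨lift fun x => s F (ψ (gen k x)), fun d => ?_⟩
  induction d using FreeCommNAAlgebra.induction with
  | zero => rw [(h D).map_zero, _root_.map_zero, _root_.map_zero, (h F).map_zero]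
  | gen x => rw [hg, lift_gen]
  | add f g hf hg => rw [(h D).map_add, _root_.map_add, hf, hg, _root_.map_add, (h F).map_add]
  | smul c f hf => rw [(h D).map_smul, _root_.map_smul, hf, _root_.map_smul, (h F).map_smul]
  | mul f g hf hg =>
    rw [(h D).map_mul, _root_.map_smul, _root_.map_mul, hf, hg, _root_.map_mul, (h F).map_mul]

theorem preservesHoms_of_isTwistIso (h : ∀ A, IsTwistIso φ α (s A)) (hg : FixesGens s) :
    PreservesHoms s where
  exists_conj := exists_conj_of_isTwistIso h hg
  exists_conj_symm χ := by
    obtain ⟨ψ, hψ⟩ := exists_conj_of_isTwistIso (fun A => (h A).symm) hg.symm χ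
    exact ⟨ψ, fun d => by rw [← Equiv.symm_apply_eq, ← hψ, Equiv.symm_apply_apply]⟩

theorem isTwistIso_mapScalars (φ : RingAut k) (A : FreeCommAlgCat k) :
    IsTwistIso φ 1 (mapScalars φ : A.Carrier ≃+ A.Carrier).toEquiv where
  map_add := map_add (mapScalars φ)
  map_smul := mapScalars_smul φ
  map_mul f g := by rw [Units.val_one, one_smul]; exact mapScalars_mul φ f g

/-- The bijection that multiplies each monomial of length `n` by `α ^ (n - 1)`. -/
noncomputable def scaleEquiv (α : kˣ) (A : FreeCommAlgCat k) : A.Carrier ≃ A.Carrier where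
  toFun f := α⁻¹ • rescale (fun _ => (α : k)) f
  invFun f := α • rescale (fun _ => (↑α⁻¹ : k)) f
  left_inv f := by
    dsimp only
    rw [Units.smul_def α⁻¹, map_smul, rescale_inv_rescale (fun _ => α), ← Units.smul_def,
      smul_inv_smul]
  right_inv f := by
    dsimp only
    rw [Units.smul_def α, map_smul, rescale_rescale_inv (fun _ => α), ← Units.smul_def,
      inv_smul_smul]

theorem scaleEquiv_gen (α : kˣ) (A : FreeCommAlgCat k) (x : A.gens) :
    scaleEquiv α A (gen k x) = gen k x := by
  change α⁻¹ • rescale _ (gen k x) = _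
  rw [rescale_gen, ← Units.smul_def, inv_smul_smul]

theorem isTwistIso_scaleEquiv (α : kˣ) (A : FreeCommAlgCat k) :
    IsTwistIso 1 α (scaleEquiv α A) where
  map_add f g := by
    change α⁻¹ • rescale _ (f + g) = α⁻¹ • rescale _ f + α⁻¹ • rescale _ g
    rw [map_add, smul_add]
  map_smul c f := by
    change α⁻¹ • rescale _ (c • f) = c • α⁻¹ • rescale _ f
    rw [map_smul, smul_comm]
  map_mul f g := by
    change α⁻¹ • rescale _ (f * g) = α • (α⁻¹ • rescale _ f * α⁻¹ • rescale _ g)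
    rw [map_mul, smul_mul_assoc, smul_inv_smul, mul_smul_comm]

end IsTwistIso

section IsTwist

/-- The bijection of type `(φ, α)` that fixes the generators. -/
noncomputable def twistEquiv (φ : RingAut k) (α : kˣ) (A : FreeCommAlgCat k) :
    A.Carrier ≃ A.Carrier :=
  (mapScalars φ).toEquiv.trans (scaleEquiv α A)

theorem isTwistIso_twistEquiv (φ : RingAut k) (α : kˣ) (A : FreeCommAlgCat k) :
    IsTwistIso φ α (twistEquiv φ α A) := by
  simpa only [twistEquiv, map_one, one_mul] using
    (isTwistIso_scaleEquiv α A).trans (isTwistIso_mapScalars φ A)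

theorem fixesGens_twistEquiv (φ : RingAut k) (α : kˣ) : FixesGens (twistEquiv φ α) := fun A x =>
  (congrArg _ (mapScalars_gen φ x)).trans (scaleEquiv_gen α A x)

/-- The strongly stable automorphism of type `(φ, α)`. -/
noncomputable def twistAuto (φ : RingAut k) (α : kˣ) : Autos k :=
  conjAuto (preservesHoms_of_isTwistIso (isTwistIso_twistEquiv φ α) (fixesGens_twistEquiv φ α))

theorem isTwist_twistAuto (φ : RingAut k) (α : kˣ) : IsTwist (twistAuto φ α) φ α :=
  ⟨twistEquiv φ α, isInducedBy_conjAuto _ (fixesGens_twistEquiv φ α), isTwistIso_twistEquiv φ α⟩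

variable {Φ Ψ : Autos k} {φ ψ : RingAut k} {α β : kˣ}

theorem IsTwist.unique (h : IsTwist Φ φ α) (h' : IsTwist Ψ φ α) : Φ = Ψ := by
  obtain ⟨s, hs, hs'⟩ := h
  obtain ⟨t, ht, ht'⟩ := h'
  obtain rfl : s = t := funext fun A => (hs' A).eq_of_gen (ht' A) fun x => by
    rw [hs.map_gen, ht.map_gen]
  exact hs.unique ht

theorem IsTwist.eq_twistAuto (h : IsTwist Φ φ α) : Φ = twistAuto φ α :=
  h.unique (isTwist_twistAuto φ α)

theorem IsTwist.param_unique (h : IsTwist Φ φ α) (h' : IsTwist Φ ψ β) : φ = ψ ∧ α = β := by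
  obtain ⟨s, hs, hφ⟩ := h
  obtain ⟨t, ht, hψ⟩ := h'
  obtain rfl := hs.eq_family ht
  let x : (one k).Carrier := gen k default
  have hx : s (one k) x = x := hs.map_gen _ _
  constructor
  · ext c
    refine smul_gen_injective (default : (one k).gens) ?_
    calc φ c • x = s _ (c • x) := by rw [(hφ _).map_smul, hx]
      _ = ψ c • x := by rw [(hψ _).map_smul, hx]
  · have hxx : (α : k) • (x * x) = (β : k) • (x * x) :=
      calc (α : k) • (x * x) = s _ (x * x) := by rw [(hφ _).map_mul, hx]
        _ = (β : k) • (x * x) := by rw [(hψ _).map_mul, hx]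
    exact Units.ext (smul_left_injective k (gen_mul_gen_ne_zero _ _) hxx)

theorem IsTwist.mul (h : IsTwist Φ φ α) (h' : IsTwist Ψ ψ β) :
    IsTwist (Φ * Ψ) (φ * ψ) (Units.map (φ : RingAut k).toMonoidHom β * α) := by
  obtain ⟨s, hs, hφ⟩ := h
  obtain ⟨t, ht, hψ⟩ := h'
  exact ⟨_, hs.mul ht, fun A => (hφ A).trans (hψ A)⟩

theorem twistAuto_mul (φ ψ : RingAut k) (α β : kˣ) :
    twistAuto φ α * twistAuto ψ β =
      twistAuto (φ * ψ) (Units.map (φ : RingAut k).toMonoidHom β * α) :=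
  ((isTwist_twistAuto φ α).mul (isTwist_twistAuto ψ β)).eq_twistAuto

theorem twistAuto_eq_mul (φ : RingAut k) (α : kˣ) :
    twistAuto φ α = twistAuto 1 α * twistAuto φ 1 := by
  rw [twistAuto_mul, one_mul, map_one, one_mul]

/-- The automorphism that multiplies the generators by the unit `α`. -/
noncomputable def rescaleIso (α : kˣ) (A : FreeCommAlgCat k) : A ≅ A where
  hom := ofAlgHom (rescale fun _ => (α : k))
  inv := ofAlgHom (rescale fun _ => (↑α⁻¹ : k))
  hom_inv_id := toAlgHom_ext (rescale_inv_rescale fun _ => α)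
  inv_hom_id := toAlgHom_ext (rescale_rescale_inv fun _ => α)

theorem rescaleIso_inv_scaleEquiv (α : kˣ) {A : FreeCommAlgCat k} (f : A.Carrier) :
    toAlgHom (rescaleIso α A).inv (scaleEquiv α A f) = (↑α⁻¹ : k) • f :=
  (map_smul (rescale fun _ => (↑α⁻¹ : k)) _ _).trans
    (congrArg _ (rescale_inv_rescale (fun _ => α) f))

theorem IsTwist.mem_inner (h : IsTwist Φ 1 α) : Φ ∈ inner k := by
  obtain ⟨s, hs, hα⟩ := h
  obtain rfl : s = scaleEquiv α := funext fun A =>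
    (hα A).eq_of_gen (isTwistIso_scaleEquiv α A) fun x => by rw [hs.map_gen, scaleEquiv_gen]
  refine hs.nonempty_iso (G := 𝟭 _) (fun A => (rescaleIso α A).symm) fun ψ d => ?_
  rw [Functor.id_map, Iso.symm_hom, Iso.symm_hom, rescaleIso_inv_scaleEquiv,
    rescaleIso_inv_scaleEquiv, map_smul]

end IsTwist

section Representability

variable {A B : FreeCommAlgCat k}

/-- The isomorphism given by a bijection of the generators. -/
noncomputable def isoOfEquiv (σ : A.gens ≃ B.gens) : A ≅ B where
  hom := ofAlgHom (lift fun x => gen k (σ x))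
  inv := ofAlgHom (lift fun x => gen k (σ.symm x))
  hom_inv_id := toAlgHom_ext_gen fun x => by simp
  inv_hom_id := toAlgHom_ext_gen fun x => by simp

theorem card_gens_le_of_retract (h : Retract A B) : A.gens.card ≤ B.gens.card := by
  have hsurj : Function.Surjective (toAlgHom h.r) := fun f =>
    ⟨toAlgHom h.i f, by rw [← toAlgHom_comp, h.retract, toAlgHom_id]⟩
  simpa only [Fintype.card_coe] using card_le_of_surjective hsurj

/-- The free algebra on one generator as a retract of the free algebra on a set containing `x`. -/
noncomputable def retractOne (x : A.gens) : Retract (one k) A where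
  i := pointEquiv A (gen k x)
  r := ofAlgHom (lift fun _ => gen k default)
  retract := by
    rw [pointEquiv_comp, toAlgHom_ofAlgHom, lift_gen, pointEquiv_gen_default]

variable (G : FreeCommAlgCat k ⥤ FreeCommAlgCat k)

theorem nonempty_gens_obj_one [G.Faithful] : Nonempty (G.obj (one k)).gens := by
  by_contra hempty
  rw [not_nonempty_iff] at hempty
  have hmap : G.map (pointEquiv (one k) 0) = G.map (pointEquiv (one k) (gen k default)) :=
    toAlgHom_ext_gen fun x => isEmptyElim x
  exact gen_ne_zero _ ((pointEquiv (one k)).injective (G.map_injective hmap)).symm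

theorem nonempty_iso_obj_one [G.IsEquivalence] : Nonempty (one k ≅ G.obj (one k)) := by
  obtain ⟨x⟩ := nonempty_gens_obj_one G.inv
  have hcard_le : (G.obj (one k)).gens.card ≤ 1 :=
    card_gens_le_of_retract <| ((retractOne x).map G).trans <|
      Retract.ofIso (G.asEquivalence.counitIso.app (one k))
  have hcard_pos : 0 < (G.obj (one k)).gens.card :=
    Finset.card_pos.2 (Finset.nonempty_coe_sort.1 (nonempty_gens_obj_one G))
  exact ⟨isoOfEquiv (Finset.equivOfCardEq (hcard_le.antisymm hcard_pos).symm)⟩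

open Limits

/-- The generators of `A` present it as a coproduct of copies of the free algebra on one
generator. -/
noncomputable def genCofan (A : FreeCommAlgCat k) : Cofan fun _ : A.gens => one k :=
  Cofan.mk A fun x => pointEquiv A (gen k x)

/-- The universal property of `genCofan`. -/
noncomputable def isColimitGenCofan (A : FreeCommAlgCat k) : IsColimit (genCofan A) :=
  Cofan.IsColimit.mk _
    (fun t => ofAlgHom (A := A) (lift fun x : A.gens => (pointEquiv t.pt).symm (t.inj x)))
    (fun t x => (pointEquiv_comp (gen k x) _).trans <| by
      rw [toAlgHom_ofAlgHom, lift_gen, Equiv.apply_symm_apply])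
    (fun t m hm => toAlgHom_ext_gen (A := A) fun x : A.gens => by
      rw [toAlgHom_ofAlgHom, lift_gen, Equiv.eq_symm_apply]
      exact (pointEquiv_comp (gen k x) _).symm.trans (hm x))

variable {G} [G.IsEquivalence] (τ : one k ≅ G.obj (one k))

/-- An equivalence that fixes the free algebra on one generator up to isomorphism fixes all its
finite coproducts up to isomorphism. -/
noncomputable def objIso (A : FreeCommAlgCat k) : A ≅ G.obj A :=
  IsColimit.coconePointsIsoOfNatIso (isColimitGenCofan A)
    (isColimitCofanMkObjOfIsColimit G _ _ (isColimitGenCofan A)) (Discrete.natIso fun _ => τ)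

theorem pointEquiv_gen_comp_objIso_hom (x : A.gens) :
    pointEquiv A (gen k x) ≫ (objIso τ A).hom = τ.hom ≫ G.map (pointEquiv A (gen k x)) :=
  IsColimit.comp_coconePointsIsoOfNatIso_hom (isColimitGenCofan A) _ _ ⟨x⟩

/-- The bijection of `A` corresponding to the action of `G` on the morphisms from `one k` to `A`,
after the identifications of these objects with their images under `G`. -/
noncomputable def inducedEquiv (A : FreeCommAlgCat k) : A.Carrier ≃ A.Carrier :=
  (pointEquiv A).trans <|
    ((Functor.FullyFaithful.ofFullyFaithful G).homEquiv.trans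
      (Iso.homCongr τ.symm (objIso τ A).symm)).trans (pointEquiv A).symm

theorem pointEquiv_inducedEquiv (f : A.Carrier) :
    pointEquiv A (inducedEquiv τ A f) = τ.hom ≫ G.map (pointEquiv A f) ≫ (objIso τ A).inv :=
  (pointEquiv A).apply_symm_apply
    (Iso.homCongr τ.symm (objIso τ A).symm (G.map (pointEquiv A f)))

theorem objIso_hom_inducedEquiv (f : A.Carrier) :
    pointEquiv (G.obj A) (toAlgHom (objIso τ A).hom (inducedEquiv τ A f)) =
      τ.hom ≫ G.map (pointEquiv A f) := by
  rw [← pointEquiv_comp, pointEquiv_inducedEquiv, Category.assoc, Category.assoc,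
    Iso.inv_hom_id, Category.comp_id]

theorem objIso_hom_inducedEquiv_map (ψ : A ⟶ B) (a : A.Carrier) :
    toAlgHom (objIso τ B).hom (inducedEquiv τ B (toAlgHom ψ a)) =
      toAlgHom (G.map ψ) (toAlgHom (objIso τ A).hom (inducedEquiv τ A a)) := by
  refine (pointEquiv (G.obj B)).injective ?_
  rw [objIso_hom_inducedEquiv, ← pointEquiv_comp, ← pointEquiv_comp, objIso_hom_inducedEquiv,
    Functor.map_comp, Category.assoc]

theorem fixesGens_inducedEquiv : FixesGens (inducedEquiv τ) := fun A x => by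
  refine (pointEquiv A).injective ?_
  rw [pointEquiv_inducedEquiv, ← Category.assoc, ← pointEquiv_gen_comp_objIso_hom, Category.assoc,
    Iso.hom_inv_id, Category.comp_id]

theorem preservesHoms_inducedEquiv : PreservesHoms (inducedEquiv τ) := by
  have hconj {D F : FreeCommAlgCat k} (ψ : D ⟶ F) (d : D.Carrier) :
      toAlgHom ((objIso τ D).hom ≫ G.map ψ ≫ (objIso τ F).inv) (inducedEquiv τ D d) =
        inducedEquiv τ F (toAlgHom ψ d) := by
    rw [toAlgHom_comp, toAlgHom_comp, ← objIso_hom_inducedEquiv_map, ← toAlgHom_comp,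
      Iso.hom_inv_id, toAlgHom_id]
  refine ⟨fun ψ => ⟨_, hconj (ofAlgHom ψ)⟩, fun {D F} χ => ?_⟩
  obtain ⟨ψ, hψ⟩ := G.map_surjective ((objIso τ D).inv ≫ ofAlgHom χ ≫ (objIso τ F).hom)
  refine ⟨toAlgHom ψ, fun d => ?_⟩
  rw [← hconj ψ, hψ]
  simp

end Representability

section OuterAutomorphisms

theorem exists_isInducedBy_iso (Φ : Autos k) :
    ∃ (Ψ : Autos k) (s : ∀ A : FreeCommAlgCat k, A.Carrier ≃ A.Carrier),
      IsInducedBy Ψ s ∧ Nonempty (functor Ψ ≅ functor Φ) := by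
  obtain ⟨τ⟩ := nonempty_iso_obj_one (functor Φ)
  have h := isInducedBy_conjAuto (preservesHoms_inducedEquiv τ) (fixesGens_inducedEquiv τ)
  exact ⟨_, _, h, h.nonempty_iso (objIso τ) (objIso_hom_inducedEquiv_map τ)⟩

theorem mk_eq_of_iso {Φ Ψ : Autos k} (e : functor Ψ ≅ functor Φ) :
    (QuotientGroup.mk Φ : Autos k ⧸ inner k) = QuotientGroup.mk Ψ :=
  QuotientGroup.eq.2
    ⟨(Functor.isoWhiskerRight e (functor Φ⁻¹)).trans (eqToIso (functor_comp_inv Φ))⟩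

/-- The homomorphism from the field automorphisms to the outer automorphisms of the category. -/
noncomputable def twistHom (k : Type*) [Field k] : RingAut k →* Autos k ⧸ inner k :=
  MonoidHom.mk' (fun φ => QuotientGroup.mk (twistAuto φ 1)) fun φ ψ => by
    rw [← QuotientGroup.mk_mul, twistAuto_mul, map_one, one_mul]

theorem mk_twistAuto (φ : RingAut k) (α : kˣ) :
    QuotientGroup.mk (twistAuto φ α) = twistHom k φ := by
  rw [twistAuto_eq_mul, QuotientGroup.mk_mul,
    (QuotientGroup.eq_one_iff _).2 (isTwist_twistAuto 1 α).mem_inner, one_mul]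
  rfl

theorem exists_hom_gen_eq_smul_gen (e : one k ≅ one k) :
    ∃ a : k, a ≠ 0 ∧ toAlgHom e.hom (gen k default) = a • gen k default := by
  have hhom : toAlgHom e.hom = lift fun _ => toAlgHom e.hom (gen k default) :=
    congrArg toAlgHom ((pointEquiv (one k)).apply_symm_apply e.hom).symm
  have hlin : IsHomogeneous 1 1 (toAlgHom e.hom (gen k default)) :=
    isHomogeneous_one_of_lift_const_eq_gen (x := default)
      (u := toAlgHom e.inv (gen k default)) <| by
      rw [← hhom, ← toAlgHom_comp, e.inv_hom_id, toAlgHom_id]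
  have ha := hlin.sum_coeff_smul_gen
  rw [Fintype.sum_unique] at ha
  refine ⟨_, fun h0 => ?_, ha.symm⟩
  rw [h0, zero_smul] at ha
  refine gen_ne_zero (k := k) (default : (one k).gens) ?_
  calc (gen k default : (one k).Carrier)
      = toAlgHom e.inv (toAlgHom e.hom (gen k default)) := by
        rw [← toAlgHom_comp, e.hom_inv_id, toAlgHom_id]
    _ = 0 := by rw [← ha, map_zero]

theorem eq_one_of_twistAuto_mem_inner {φ : RingAut k} {α : kˣ} (h : twistAuto φ α ∈ inner k) :
    φ = 1 := by
  obtain ⟨e⟩ := h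
  let η : one k ≅ one k := e.app (one k)
  obtain ⟨a, ha0, ha⟩ := exists_hom_gen_eq_smul_gen η
  ext c
  let x : (one k).Carrier := gen k default
  let hs := preservesHoms_of_isTwistIso (isTwistIso_twistEquiv φ α) (fixesGens_twistEquiv φ α)
  let ψ : one k ⟶ one k := pointEquiv _ (c • x)
  have hψ : toAlgHom ψ x = c • x := toAlgHom_pointEquiv_gen _ _
  have hconj : toAlgHom (conj hs ψ) x = φ c • x := by
    have h := conj_apply hs ψ x
    rwa [fixesGens_twistEquiv, hψ, (isTwistIso_twistEquiv φ α _).map_smul,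
      fixesGens_twistEquiv] at h
  have hnat : toAlgHom η.hom (toAlgHom (conj hs ψ) x) = toAlgHom ψ (toAlgHom η.hom x) :=
    congrArg (fun f => toAlgHom f x) (e.hom.naturality ψ)
  rw [hconj, ha, map_smul, map_smul, ha, hψ, smul_smul, smul_smul, mul_comm a] at hnat
  exact mul_right_cancel₀ ha0 (smul_gen_injective _ hnat)

theorem twistHom_injective : Function.Injective (twistHom k) :=
  (injective_iff_map_eq_one _).2 fun _ h =>
    eq_one_of_twistAuto_mem_inner ((QuotientGroup.eq_one_iff _).1 h)

variable [Infinite k]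

theorem IsInducedBy.exists_isTwist {Φ : Autos k}
    {s : ∀ A : FreeCommAlgCat k, A.Carrier ≃ A.Carrier} (h : IsInducedBy Φ s) :
    ∃ (φ : RingAut k) (α : kˣ), IsTwist Φ φ α := by
  obtain ⟨φ, α, hs⟩ := h.preservesHoms.exists_isTwistIso h.fixesGens
  exact ⟨φ, α, s, h, hs⟩

theorem twistHom_surjective : Function.Surjective (twistHom k) := fun x => by
  obtain ⟨Φ, rfl⟩ := QuotientGroup.mk_surjective x
  obtain ⟨Ψ, s, hs, ⟨e⟩⟩ := exists_isInducedBy_iso Φ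
  obtain ⟨φ, α, hΨ⟩ := hs.exists_isTwist
  exact ⟨φ, by rw [mk_eq_of_iso e, hΨ.eq_twistAuto, mk_twistAuto]⟩

theorem twistHom_bijective : Function.Bijective (twistHom k) :=
  ⟨twistHom_injective, twistHom_surjective⟩

end OuterAutomorphisms

end FreeCommAlgCat

theorem mainTheorem3_general (k : Type*) [Field k] [Infinite k] :
    ∃ e : (FreeCommAlgCat.Autos k ⧸ FreeCommAlgCat.inner k) ≃* RingAut k,
      (∀ Φ : FreeCommAlgCat.Autos k, FreeCommAlgCat.IsStronglyStable Φ →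
        ∃! p : RingAut k × kˣ, FreeCommAlgCat.IsTwist Φ p.1 p.2) ∧
      (∀ (φ : RingAut k) (α : kˣ),
        ∃! Φ : FreeCommAlgCat.Autos k, FreeCommAlgCat.IsTwist Φ φ α) ∧
      (∀ (φ : RingAut k) (α : kˣ) (Φ Υ Ψ : FreeCommAlgCat.Autos k),
        FreeCommAlgCat.IsTwist Φ φ α → FreeCommAlgCat.IsTwist Υ 1 α →
        FreeCommAlgCat.IsTwist Ψ φ 1 → Φ = Υ * Ψ ∧ Υ ∈ FreeCommAlgCat.inner k) ∧
      (∀ (φ : RingAut k) (α : kˣ) (Φ : FreeCommAlgCat.Autos k),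
        FreeCommAlgCat.IsTwist Φ φ α → e (QuotientGroup.mk Φ) = φ) := by
  refine ⟨(MulEquiv.ofBijective _ FreeCommAlgCat.twistHom_bijective).symm, ?_, ?_, ?_, ?_⟩
  · rintro Φ ⟨s, hs⟩
    obtain ⟨φ, α, h⟩ := hs.exists_isTwist
    exact ⟨(φ, α), h, fun p hp => Prod.ext_iff.2 (hp.param_unique h)⟩
  · exact fun φ α => ⟨_, FreeCommAlgCat.isTwist_twistAuto φ α, fun Φ h => h.eq_twistAuto⟩
  · intro φ α Φ Υ Ψ hΦ hΥ hΨ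
    refine ⟨?_, hΥ.mem_inner⟩
    rw [hΦ.eq_twistAuto, hΥ.eq_twistAuto, hΨ.eq_twistAuto, FreeCommAlgCat.twistAuto_eq_mul]
  · intro φ α Φ h
    rw [MulEquiv.symm_apply_eq, h.eq_twistAuto, FreeCommAlgCat.mk_twistAuto]
    rfl

theorem mainTheorem3 (k : Type*) [Field k] [CharZero k] :
    ∃ e : (FreeCommAlgCat.Autos k ⧸ FreeCommAlgCat.inner k) ≃* RingAut k,
      (∀ Φ : FreeCommAlgCat.Autos k, FreeCommAlgCat.IsStronglyStable Φ →
        ∃! p : RingAut k × kˣ, FreeCommAlgCat.IsTwist Φ p.1 p.2) ∧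
      (∀ (φ : RingAut k) (α : kˣ),
        ∃! Φ : FreeCommAlgCat.Autos k, FreeCommAlgCat.IsTwist Φ φ α) ∧
      (∀ (φ : RingAut k) (α : kˣ) (Φ Υ Ψ : FreeCommAlgCat.Autos k),
        FreeCommAlgCat.IsTwist Φ φ α → FreeCommAlgCat.IsTwist Υ 1 α →
        FreeCommAlgCat.IsTwist Ψ φ 1 → Φ = Υ * Ψ ∧ Υ ∈ FreeCommAlgCat.inner k) ∧
      (∀ (φ : RingAut k) (α : kˣ) (Φ : FreeCommAlgCat.Autos k),
        FreeCommAlgCat.IsTwist Φ φ α → e (QuotientGroup.mk Φ) = φ) :=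
  mainTheorem3_general k
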